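/- **Theorem.** Let $I$ be a set, let $G_j$ ($j\in I$) be nontrivial groups, and let $G=\amalg_{j\in I}G_j$ be their free product, each $G_j$ being identified with its image in $G$. Let $i\in I$, let $N$ be a nontrivial normal subgroup of $G_i$, and let $H$ be the normal closure of $N$ in $G$, i.e. the smallest normal subgroup of $G$ containing $N$. For a subgroup $K$ of $H$ write $H=N\amalg K$ if $H$ is the internal free product of $N$ and $K$, i.e. if the homomorphism from the free product of the groups $N$ and $K$ to $G$ that restricts to the inclusions of $N$ and of $K$ is injective with image $H$. (Here $K$ may be trivial, as happens when $I=\{i\}$.) Then there is a subgroup $K$ of $H$ such that $H=N\amalg K$; in particular, $N$ is a free factor of $H$. Moreover, $K$ is unique up to isomorphism: if $K$ and $K'$ are subgroups of $H$ with $H=N\amalg K$ and $H=N\amalg K'$, then $K\cong K'$. -/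

import Mathlib

/-- The subgroup `H` of `G` is the (internal) free product of the subgroups `A` and `B` of `G`:
the homomorphism from the free product of the groups `A` and `B` to `G` that restricts to the
inclusions of `A` and of `B` is injective, and its image is `H`. -/
def Subgroup.IsFreeProduct {G : Type*} [Group G] (H A B : Subgroup G) : Prop :=
  Function.Injective (Monoid.Coprod.lift A.subtype B.subtype) ∧
    (Monoid.Coprod.lift A.subtype B.subtype).range = H

/-!
Uniqueness is formal: if `H = N ∐ K`, then `K` is the quotient of `H` by the normal closure of `N`
in `H`, whatever `K` is (`Subgroup.IsFreeProduct.nonempty_mulEquiv`).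

For existence, let `M j ⊴ G j` be a family of normal subgroups (`N` at `i`, trivial elsewhere), and
let `Q` be the free product of the quotients `G j ⧸ M j`, which is the quotient of `G` by the normal
closure `H` of all the `M j`. Choose sections `G j ⧸ M j → G j` sending `1` to `1`; lifting reduced
words letter by letter gives a section `σ : Q → G`. The claim is that `H` is the free product of the
conjugates `σ(t)⁻¹ (M j) σ(t)`, where `j` is an index and `t` is a reduced word that does not begin
with a letter from `G j ⧸ M j`. For `j = i` and `t = 1` the conjugate is `N` itself, and the other
ones generate `K`.

To prove the claim, let `F` be the external free product of these groups and `φ : F → G` the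
evident homomorphism. The group `G` acts on `Q × F` (`extAction`) as it would act on itself
if every element were written uniquely as `σ(q) φ(f)`: an element `g` of `G j` sends `(a t, f)`,
where `a ∈ G j ⧸ M j` and `t` does not begin with a letter from `G j ⧸ M j`, to `(g a t, c f)`, where
`c` is the element `sec(g a)⁻¹ g sec(a)` of `M j`, placed in the factor of `F` indexed by `(j, t)`.
Because `G` is a free product, this defines an action as soon as it does so on each factor, which is
the cocycle identity for `c`. The map `(q, f) ↦ σ(q) φ(f)` is equivariant
(`extMap_extAction`), and the orbit map at `(1, 1)` is inverse to it: `σ(q) φ(f) (1, 1) = (q, f)`, by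
`extAction_conjHom` and `extAction_wordLift`. So `φ` is injective, and an element of `H`,
which fixes the `Q`-component, lies in the image of `φ`
(`range_conjHom`).
-/

open Monoid Monoid.CoprodI

/-! ### Complements of a free factor -/

theorem Monoid.Coprod.ker_snd_eq_normalClosure {A B : Type*} [Group A] [Group B] :
    (Coprod.snd : Coprod A B →* B).ker =
      Subgroup.normalClosure (Set.range (Coprod.inl : A →* Coprod A B)) := by
  apply le_antisymm
  · -- Modulo the normal closure, every element agrees with its projection to `B`.
    intro x hx
    have h : QuotientGroup.mk' (Subgroup.normalClosure
        (Set.range (Coprod.inl : A →* Coprod A B))) =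
        (QuotientGroup.mk' _).comp (Coprod.inr.comp Coprod.snd) := by
      refine Coprod.hom_ext ?_ rfl
      ext a
      simpa using Subgroup.subset_normalClosure (Set.mem_range_self a)
    have h' := DFunLike.congr_fun h x
    rw [MonoidHom.mem_ker] at hx
    simpa [hx] using h'
  · refine Subgroup.normalClosure_le_normal ?_
    rintro _ ⟨a, rfl⟩
    simp [MonoidHom.mem_ker]

/-- The complement of a free factor `A` of `H` is determined up to isomorphism, being the quotient
of `H` by the normal closure of `A` in `H`. -/
theorem Subgroup.IsFreeProduct.nonempty_mulEquiv {G : Type*} [Group G] {H A K K' : Subgroup G}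
    (h : H.IsFreeProduct A K) (h' : H.IsFreeProduct A K') : Nonempty (K ≃* K') := by
  let e : Coprod A K ≃* Coprod A K' :=
    (MonoidHom.ofInjective h.1).trans
      ((MulEquiv.subgroupCongr (h.2.trans h'.2.symm)).trans (MonoidHom.ofInjective h'.1).symm)
  have he : ∀ a : A, e (Coprod.inl a) = Coprod.inl a := fun a => by
    simp only [e, MulEquiv.trans_apply, MulEquiv.symm_apply_eq]
    apply Subtype.ext
    change Coprod.lift A.subtype K.subtype (Coprod.inl a) =
      Coprod.lift A.subtype K'.subtype (Coprod.inl a)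
    simp
  have hker : (Coprod.snd : Coprod A K →* K).ker.map e.toMonoidHom =
      (Coprod.snd : Coprod A K' →* K').ker := by
    rw [Coprod.ker_snd_eq_normalClosure, Coprod.ker_snd_eq_normalClosure,
      Subgroup.map_normalClosure _ _ e.surjective, ← Set.range_comp]
    congr 2
    ext a
    exact he a
  exact ⟨(QuotientGroup.quotientKerEquivOfSurjective _ Coprod.snd_surjective).symm.trans
    ((QuotientGroup.congr _ _ e hker).trans
      (QuotientGroup.quotientKerEquivOfSurjective _ Coprod.snd_surjective))⟩

/-- The subgroups of a free product generated by a single factor and by all the other factors form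
an internal free product. -/
theorem Monoid.CoprodI.injective_lift_of_lift {X : Type*} {A : X → Type*} [∀ x, Group (A x)]
    (x₀ : X) :
    Function.Injective (Coprod.lift (of : A x₀ →* CoprodI A)
      (CoprodI.lift fun x : {x // x ≠ x₀} => (of : A x →* CoprodI A))) := by
  classical
  -- A left inverse comes from the universal property.
  let r : CoprodI A →* Coprod (A x₀) (CoprodI fun x : {x // x ≠ x₀} => A x) :=
    CoprodI.lift fun x =>
      if h : x = x₀ then h.symm.rec
        (Coprod.inl : A x₀ →* Coprod (A x₀) (CoprodI fun x : {x // x ≠ x₀} => A x))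
      else Coprod.inr.comp
        (of (M := fun x : {x // x ≠ x₀} => A x) (i := ⟨x, h⟩) : A x →* _)
  have hr : r.comp (Coprod.lift (of : A x₀ →* CoprodI A)
      (CoprodI.lift fun x : {x // x ≠ x₀} => (of : A x →* CoprodI A))) = MonoidHom.id _ := by
    refine Coprod.hom_ext ?_ ?_
    · ext a
      simp [r]
    · refine CoprodI.ext_hom _ _ ?_
      rintro ⟨x, hx⟩
      ext a
      simp [r, hx]
  exact Function.LeftInverse.injective (DFunLike.congr_fun hr)

/-- If `f` embeds a free product in a group, the image of `f` is the internal free product of the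
image of any one factor and of another subgroup. -/
theorem Monoid.CoprodI.exists_isFreeProduct_range {X : Type*} {A : X → Type*} [∀ x, Group (A x)]
    {G : Type*} [Group G] (f : CoprodI A →* G) (hf : Function.Injective f) (x₀ : X) :
    ∃ K ≤ f.range, f.range.IsFreeProduct (f.comp (of : A x₀ →* CoprodI A)).range K := by
  set k : CoprodI (fun x : {x // x ≠ x₀} => A x) →* CoprodI A :=
    CoprodI.lift fun x => of with hk
  have hinj := injective_lift_of_lift (A := A) x₀
  rw [← hk] at hinj
  have hkinj : Function.Injective k := by
    have := hinj.comp Coprod.inr_injective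
    rwa [← MonoidHom.coe_comp, Coprod.lift_comp_inr] at this
  refine ⟨(f.comp k).range, ?_, ?_, ?_⟩
  · rintro _ ⟨b, rfl⟩
    exact ⟨k b, rfl⟩
  · let e := MulEquiv.coprodCongr
      (MonoidHom.ofInjective (f := f.comp (of : A x₀ →* CoprodI A)) (hf.comp (of_injective x₀)))
      (MonoidHom.ofInjective (f := f.comp k) (hf.comp hkinj))
    have he : (Coprod.lift (f.comp (of : A x₀ →* CoprodI A)).range.subtype
        (f.comp k).range.subtype).comp e.toMonoidHom = f.comp (Coprod.lift of k) :=
      Coprod.hom_ext rfl rfl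
    have hcomp : Function.Injective (⇑(Coprod.lift (f.comp (of : A x₀ →* CoprodI A)).range.subtype
        (f.comp k).range.subtype) ∘ e) := by
      have : Function.Injective (f.comp (Coprod.lift of k)) := hf.comp hinj
      rwa [← he] at this
    exact (Function.Injective.of_comp_iff' _ e.bijective).1 hcomp
  · rw [Coprod.range_lift, Subgroup.range_subtype, Subgroup.range_subtype]
    apply le_antisymm
    · rw [MonoidHom.range_comp, MonoidHom.range_comp, ← Subgroup.map_sup]
      exact Subgroup.map_le_range _ _
    · rw [← CoprodI.lift_comp_of' f]
      refine CoprodI.lift_range_le _ _ fun x => ?_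
      by_cases hx : x = x₀
      · subst hx
        exact le_sup_left
      · refine le_trans ?_ le_sup_right
        rintro _ ⟨a, rfl⟩
        exact ⟨of (M := fun x : {x // x ≠ x₀} => A x) (i := ⟨x, hx⟩) a, by simp [k]⟩

/-! ### Sections and cocycles of a quotient group -/

namespace Monoid.CoprodI

/-- A set-theoretic section of the quotient map `G ⧸ M → G` that sends `1` to `1`. -/
noncomputable def unitSection {G : Type*} [Group G] (M : Subgroup G) [M.Normal] (q : G ⧸ M) : G :=
  open Classical in if q = 1 then 1 else q.out

@[simp]
theorem unitSection_one {G : Type*} [Group G] (M : Subgroup G) [M.Normal] :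
    unitSection M 1 = 1 := by
  simp [unitSection]

@[simp]
theorem mk_unitSection {G : Type*} [Group G] (M : Subgroup G) [M.Normal] (q : G ⧸ M) :
    ((unitSection M q : G) : G ⧸ M) = q := by
  unfold unitSection
  split_ifs with h
  · simp [h]
  · simp

/-- The cocycle `sec(g a)⁻¹ g sec(a) ∈ M` that measures the failure of the section to be
equivariant. -/
noncomputable def sectionCocycle {G : Type*} [Group G] (M : Subgroup G) [M.Normal]
    (g : G) (a : G ⧸ M) : M :=
  ⟨(unitSection M (g * a))⁻¹ * g * unitSection M a, by
    rw [← QuotientGroup.eq_one_iff]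
    simp [mul_assoc]⟩

theorem sectionCocycle_mul {G : Type*} [Group G] (M : Subgroup G) [M.Normal]
    (g g' : G) (a : G ⧸ M) :
    sectionCocycle M (g * g') a = sectionCocycle M g (g' * a) * sectionCocycle M g' a := by
  apply Subtype.ext
  simp [sectionCocycle, mul_assoc]

@[simp]
theorem sectionCocycle_one {G : Type*} [Group G] (M : Subgroup G) [M.Normal] (a : G ⧸ M) :
    sectionCocycle M 1 a = 1 := by
  apply Subtype.ext
  simp [sectionCocycle]

/-! ### The free product of conjugates -/

variable {ι : Type*} {G : ι → Type*} [∀ j, Group (G j)] (M : ∀ j, Subgroup (G j))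
  [∀ j, (M j).Normal]

/-- Reduced words in the quotients `G j ⧸ M j`, that is, the elements of the free product of the
quotients in normal form. -/
abbrev QuotWord : Type _ := Word fun j => G j ⧸ M j

/-- A letter from `G j ⧸ M j`, possibly `1`, and a reduced word that does not begin with such a
letter. -/
abbrev QuotPair (j : ι) : Type _ := Word.Pair (fun j => G j ⧸ M j) j

/-- The index set of the conjugates of which the normal closure is the free product: pairs of an
index `j` and a reduced word `t` that does not begin with a letter from `G j ⧸ M j`. -/
abbrev ConjIndex : Type _ := Σ j, {t : QuotWord M // t.fstIdx ≠ some j}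

/-- The external free product of copies of the `M j`, one for each element `(j, t)` of the index
set. -/
abbrev ConjProd : Type _ := CoprodI fun x : ConjIndex M => M x.1

/-- The inclusion of the factor of `ConjProd M` indexed by `(j, t)`. -/
abbrev conjOf {j : ι} (t : QuotWord M) (ht : t.fstIdx ≠ some j) : M j →* ConjProd M :=
  of (M := fun x : ConjIndex M => M x.1) (i := ⟨j, t, ht⟩)

/-- The section `σ`: a reduced word in the quotients is lifted letter by letter. -/
noncomputable def wordLift (w : QuotWord M) : CoprodI G :=
  (w.toList.map fun l => of (unitSection (M l.1) l.2)).prod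

@[simp]
theorem wordLift_empty : wordLift M Word.empty = 1 := rfl

theorem wordLift_cons {j : ι} (m : G j ⧸ M j) (w : QuotWord M) (h h1) :
    wordLift M (Word.cons m w h h1) = of (unitSection (M j) m) * wordLift M w := by
  simp [wordLift, Word.cons]

/-- The homomorphism `φ` that sends the factor indexed by `(j, t)` to the conjugate
`σ(t)⁻¹ (M j) σ(t)`. -/
noncomputable def conjHom : ConjProd M →* CoprodI G :=
  CoprodI.lift fun x =>
    (MulAut.conj (wordLift M x.2.1)⁻¹).toMonoidHom.comp (of.comp (M x.1).subtype)

theorem conjHom_conjOf {j : ι} (t : QuotWord M) (ht : t.fstIdx ≠ some j) (n : M j) :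
    conjHom M (conjOf M t ht n) = (wordLift M t)⁻¹ * of (n : G j) * wordLift M t := by
  simp [conjHom]

/-- The quotient map from the free product to the free product of the quotients. -/
def quotHom : CoprodI G →* CoprodI fun j => G j ⧸ M j :=
  CoprodI.lift fun j => (of (M := fun j => G j ⧸ M j)).comp (QuotientGroup.mk' (M j))

@[simp]
theorem quotHom_of {j : ι} (g : G j) :
    quotHom M (of g) = of (M := fun j => G j ⧸ M j) (g : G j ⧸ M j) := by
  simp [quotHom]

/-- The map `(q, f) ↦ σ(q) φ(f)`. -/
noncomputable def extMap (x : QuotWord M × ConjProd M) : CoprodI G :=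
  wordLift M x.1 * conjHom M x.2

variable [∀ j, DecidableEq (G j ⧸ M j)]

theorem wordLift_rcons {j : ι} (p : QuotPair M j) :
    wordLift M (Word.rcons p) = of (unitSection (M j) p.head) * wordLift M p.tail := by
  unfold Word.rcons
  split_ifs with h
  · simp [h]
  · exact wordLift_cons M _ _ _ _

/-! ### The action on normal forms -/

variable [DecidableEq ι]

/-- The map by which an element `g` of one factor `G j` acts on pairs `(q, f)`: with `q = a t`, where
`a ∈ G j ⧸ M j` and `t` does not begin with a letter from `G j ⧸ M j`, the letter `a` is multiplied
by `g` and the value of the cocycle is put in the factor of `f` indexed by `(j, t)`. -/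
noncomputable def factorMap {j : ι} (g : G j) (x : QuotWord M × ConjProd M) :
    QuotWord M × ConjProd M :=
  (Word.rcons (⟨g * (Word.equivPair j x.1).head, (Word.equivPair j x.1).tail,
      (Word.equivPair j x.1).fstIdx_ne⟩ : QuotPair M j),
    conjOf M (Word.equivPair j x.1).tail (Word.equivPair j x.1).fstIdx_ne
      (sectionCocycle (M j) g (Word.equivPair j x.1).head) * x.2)

theorem factorMap_rcons {j : ι} (g : G j) (p : QuotPair M j) (f : ConjProd M) :
    factorMap M g (Word.rcons p, f) =
      (Word.rcons (⟨g * p.head, p.tail, p.fstIdx_ne⟩ : QuotPair M j),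
        conjOf M p.tail p.fstIdx_ne (sectionCocycle (M j) g p.head) * f) := by
  simp [factorMap, ← Word.equivPair_symm]

/-- The action of one factor `G j` on pairs `(q, f)`. -/
noncomputable def factorAction (j : ι) : G j →* Function.End (QuotWord M × ConjProd M) where
  toFun g := factorMap M g
  map_one' := by
    funext x
    change factorMap M 1 x = x
    simp only [factorMap, QuotientGroup.mk_one, one_mul, sectionCocycle_one, map_one]
    exact Prod.ext ((Word.equivPair j).symm_apply_apply x.1) rfl
  map_mul' g g' := by
    funext x
    change factorMap M (g * g') x = factorMap M g (factorMap M g' x)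
    obtain ⟨w, f⟩ := x
    obtain ⟨p, rfl⟩ := (Word.equivPair (M := fun j => G j ⧸ M j) j).symm.surjective w
    simp only [Word.equivPair_symm, factorMap_rcons, sectionCocycle_mul, map_mul, mul_assoc,
      QuotientGroup.mk_mul]

/-- The action of the free product on pairs `(q, f)`, which imitates left multiplication on the
elements `σ(q) φ(f)`. -/
noncomputable def extAction : CoprodI G →* Function.End (QuotWord M × ConjProd M) :=
  CoprodI.lift (factorAction M)

theorem extAction_of_rcons {j : ι} (g : G j) (p : QuotPair M j)
    (f : ConjProd M) :
    extAction M (of g) (Word.rcons p, f) =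
      (Word.rcons (⟨g * p.head, p.tail, p.fstIdx_ne⟩ : QuotPair M j),
        conjOf M p.tail p.fstIdx_ne (sectionCocycle (M j) g p.head) * f) := by
  rw [extAction, CoprodI.lift_of]
  exact factorMap_rcons M g p f

theorem extAction_of_tail {j : ι} (g : G j) (t : QuotWord M) (ht : t.fstIdx ≠ some j)
    (f : ConjProd M) :
    extAction M (of g) (t, f) =
      (Word.rcons (⟨g, t, ht⟩ : QuotPair M j),
        conjOf M t ht (sectionCocycle (M j) g 1) * f) := by
  -- As `t` does not begin with a letter from `G j ⧸ M j`, its head at `j` is `1`.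
  have h := extAction_of_rcons M g (⟨1, t, ht⟩ : QuotPair M j) f
  rw [show Word.rcons (⟨1, t, ht⟩ : QuotPair M j) = t from dif_pos rfl] at h
  simpa only [mul_one] using h

theorem extAction_mul_apply (g g' : CoprodI G) (x : QuotWord M × ConjProd M) :
    extAction M (g * g') x = extAction M g (extAction M g' x) := by
  rw [map_mul]
  rfl

/-- The map `(q, f) ↦ σ(q) φ(f)` is equivariant, which is what the choice of cocycle achieves. -/
theorem extMap_extAction (g : CoprodI G) (x : QuotWord M × ConjProd M) :
    extMap M (extAction M g x) = g * extMap M x := by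
  induction g using CoprodI.induction_on generalizing x with
  | one => rw [map_one, one_mul]; rfl
  | mul g g' h h' => rw [extAction_mul_apply, h, h', mul_assoc]
  | @of j g =>
    obtain ⟨w, f⟩ := x
    obtain ⟨p, rfl⟩ := (Word.equivPair (M := fun j => G j ⧸ M j) j).symm.surjective w
    rw [Word.equivPair_symm, extAction_of_rcons]
    simp [extMap, wordLift_rcons, conjHom_conjOf, sectionCocycle, mul_assoc]

/-- The first component of the action is the action of the quotient free product on words. -/
theorem fst_extAction (g : CoprodI G) (x : QuotWord M × ConjProd M) :
    (extAction M g x).1 = quotHom M g • x.1 := by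
  induction g using CoprodI.induction_on generalizing x with
  | one => rw [map_one, map_one, one_smul]; rfl
  | mul g g' h h' => rw [extAction_mul_apply, h, h', map_mul, mul_smul]
  | @of j g =>
    obtain ⟨w, f⟩ := x
    obtain ⟨p, rfl⟩ := (Word.equivPair (M := fun j => G j ⧸ M j) j).symm.surjective w
    rw [Word.equivPair_symm, extAction_of_rcons]
    simp [Word.of_smul_def, ← Word.equivPair_symm]

/-- Lifted words move the base point without contributing to the second component. -/
theorem extAction_wordLift (w : QuotWord M) (f : ConjProd M) :
    extAction M (wordLift M w) (Word.empty, f) = (w, f) := by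
  induction w using Word.consRecOn with
  | empty => rw [wordLift_empty, map_one]; rfl
  | cons j m w h h1 ih =>
    rw [wordLift_cons, extAction_mul_apply, ih, extAction_of_tail M _ w h]
    refine Prod.ext ?_ ?_
    · simp [Word.rcons, h1]
    · have : sectionCocycle (M j) (unitSection (M j) m) 1 = 1 := by
        apply Subtype.ext
        simp [sectionCocycle]
      simp [this]

/-- On the pairs with first component `1`, the element `φ(f)` acts as left multiplication by
`f`; this makes `φ` injective. -/
theorem extAction_conjHom (f f' : ConjProd M) :
    extAction M (conjHom M f) (Word.empty, f') = (Word.empty, f * f') := by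
  induction f using CoprodI.induction_on generalizing f' with
  | one => rw [map_one, map_one, one_mul]; rfl
  | mul f₁ f₂ h₁ h₂ => rw [map_mul, extAction_mul_apply, h₂, h₁, mul_assoc]
  | @of x n =>
    obtain ⟨j, t, ht⟩ := x
    -- The conjugate `σ(t)⁻¹ n σ(t)` moves the first component to `t`, where `n` acts on the second
    -- component alone, and back.
    change M j at n
    change extAction M (conjHom M (conjOf M t ht n)) (Word.empty, f') =
      (Word.empty, conjOf M t ht n * f')
    have hn : extAction M (of (n : G j)) (t, f') = (t, conjOf M t ht n * f') := by
      rw [extAction_of_tail M _ t ht]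
      have h1 : ((n : G j) : G j ⧸ M j) = 1 := (QuotientGroup.eq_one_iff _).2 n.2
      refine Prod.ext ?_ ?_
      · simp [Word.rcons, h1]
      · have : sectionCocycle (M j) n 1 = n := by
          apply Subtype.ext
          simp [sectionCocycle, h1]
        simp [this]
    rw [conjHom_conjOf, extAction_mul_apply, extAction_wordLift, extAction_mul_apply, hn,
      ← extAction_wordLift M t, ← extAction_mul_apply, inv_mul_cancel, map_one]
    rfl

/-! ### The normal closure as a free product of conjugates -/

theorem conjHom_injective : Function.Injective (conjHom M) := by
  intro f f' h
  have := (extAction_conjHom M f 1).symm.trans (h ▸ extAction_conjHom M f' 1)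
  simpa using this

/-- The normal closure of a family of normal subgroups of the factors is the image of `φ`. -/
theorem range_conjHom :
    (conjHom M).range =
      Subgroup.normalClosure (⋃ j, ((M j).map (of : G j →* CoprodI G) : Set (CoprodI G))) := by
  apply le_antisymm
  · refine CoprodI.lift_range_le _ _ ?_
    rintro x _ ⟨n, rfl⟩
    refine Subgroup.normalClosure_normal.conj_mem _ (Subgroup.subset_normalClosure ?_) _
    exact Set.mem_iUnion.2 ⟨x.1, n, n.2, rfl⟩
  · intro g hg
    have hker : Subgroup.normalClosure
        (⋃ j, ((M j).map (of : G j →* CoprodI G) : Set (CoprodI G))) ≤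
        (quotHom M).ker := by
      refine Subgroup.normalClosure_le_normal (Set.iUnion_subset fun j => ?_)
      rintro _ ⟨n, hn, rfl⟩
      have : (n : G j ⧸ M j) = 1 := (QuotientGroup.eq_one_iff _).2 hn
      simp [MonoidHom.mem_ker, this]
    -- `g` fixes the first component of the base point, so its orbit map lands in the second one.
    have h1 : (extAction M g (Word.empty, 1)).1 = Word.empty := by
      rw [fst_extAction, MonoidHom.mem_ker.1 (hker hg), one_smul]
    refine ⟨(extAction M g (Word.empty, 1)).2, ?_⟩
    have h2 := extMap_extAction M g (Word.empty, 1)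
    simpa [extMap, h1] using h2

end Monoid.CoprodI

/-! ### Existence and uniqueness of the complement -/

theorem mainTheorem1 {I : Type*} (G : I → Type*) [∀ j, Group (G j)] [∀ j, Nontrivial (G j)]
    (i : I) (N : Subgroup (G i)) (hN : N.Normal) (hN_ne : N ≠ ⊥)
    (H : Subgroup (Monoid.CoprodI G))
    (hH : H = Subgroup.normalClosure
      (N.map (Monoid.CoprodI.of : G i →* Monoid.CoprodI G) : Set (Monoid.CoprodI G))) :
    (∃ K : Subgroup (Monoid.CoprodI G), K ≤ H ∧
      H.IsFreeProduct (N.map (Monoid.CoprodI.of : G i →* Monoid.CoprodI G)) K) ∧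
    (∀ K K' : Subgroup (Monoid.CoprodI G), K ≤ H → K' ≤ H →
      H.IsFreeProduct (N.map (Monoid.CoprodI.of : G i →* Monoid.CoprodI G)) K →
      H.IsFreeProduct (N.map (Monoid.CoprodI.of : G i →* Monoid.CoprodI G)) K' →
      Nonempty (K ≃* K')) := by
  refine ⟨?_, fun K K' _ _ h h' => h.nonempty_mulEquiv h'⟩
  classical
  -- The family of normal subgroups that is `N` at `i` and trivial elsewhere.
  let M : ∀ j, Subgroup (G j) := Function.update (fun _ => ⊥) i N
  have hMi : M i = N := Function.update_self ..
  have hMj : ∀ j, j ≠ i → M j = ⊥ := fun j hj => Function.update_of_ne hj ..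
  have hM : ∀ j, (M j).Normal := fun j => by
    by_cases hj : j = i
    · subst hj
      rwa [hMi]
    · rw [hMj j hj]
      infer_instance
  have hHM : (conjHom M).range = H := by
    rw [range_conjHom, hH]
    apply le_antisymm
    · refine Subgroup.normalClosure_le_normal (Set.iUnion_subset fun j => ?_)
      by_cases hj : j = i
      · subst hj
        rw [hMi]
        exact Subgroup.subset_normalClosure
      · rw [hMj j hj]
        simp
    · refine Subgroup.normalClosure_mono ?_
      rw [← hMi]
      exact Set.subset_iUnion (fun j => ((M j).map (of : G j →* CoprodI G) : Set (CoprodI G))) i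
  let x₀ : ConjIndex M := ⟨i, Word.empty, by simp [Word.fstIdx]⟩
  have hx₀ : ((conjHom M).comp (conjOf M x₀.2.1 x₀.2.2 : M i →* ConjProd M)).range =
      N.map (of : G i →* CoprodI G) := by
    have : (conjHom M).comp (conjOf M x₀.2.1 x₀.2.2 : M i →* ConjProd M) =
        of.comp (M i).subtype := by
      ext n
      simpa [x₀] using conjHom_conjOf M Word.empty x₀.2.2 n
    rw [this, MonoidHom.range_comp, Subgroup.range_subtype, hMi]
  have := exists_isFreeProduct_range (conjHom M) (conjHom_injective M) x₀
  rwa [hHM, hx₀] at this
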